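/- For each sufficiently large $n$ let $X_1,\dots,X_n$ (whose joint distribution may depend on $n$) be identically distributed, $1$-dependent random variables with values in the non-negative integers, where $1$-dependent means that $\sigma(X_1,\dots,X_s)$ and $\sigma(X_t,\dots,X_n)$ are independent whenever $1\le s<t\le n$ and $t-s>1$. Assume also that $E X_kX_{k+1}\le E X_1X_2$ for $1\le k<n$ (with equality, for instance, if the sequence is stationary). Let $x=x(n)$ be a positive integer and put $$S_n=X_1+\dots+X_n,\quad \nu_1=E X_1>0,\quad \nu_2=E X_1(X_1-1),\quad y=\frac{x-n\nu_1}{n\nu_1}.$$ Suppose that for some constant $C_0\ge 1$ not depending on $n$, and for all sufficiently large $n$, $$X_1\le C_0\ \text{a.s.},\quad e^{5C_0}\nu_1\le 0.002,\quad |y|\le \tfrac1{10},\quad \nu_2\le \frac{\nu_1e^{-1.5C_0}}{20},\quad E X_1X_2\le \frac{\nu_1e^{-1.5C_0}}{20},\quad x>n\nu_1.$$ Let $\gamma=e^{1.5C_0}\max(\nu_1^2,\nu_2,E X_1X_2)$ and let $Z_n^*$ be a Poisson random variable with parameter $n\lambda^*$, where $\lambda^*=\nu_1\bigl(1-\frac{\nu_1}{1-\nu_1}y\bigr)$.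 If $x-n\nu_1=O(\sqrt{n\nu_1})$, $\gamma=O(\nu_1^2)$ and $n\nu_1^3=o(1)$ as $n\to\infty$, then $$\frac{P(S_n\ge x)}{P(Z_n^*\ge x)}=1+o(1)\qquad (n\to\infty).$$ -/

import Mathlib

open MeasureTheory ProbabilityTheory Filter Topology Asymptotics

noncomputable section

namespace PoissonLD

variable {Ω : Type*} [MeasurableSpace Ω]

/-- The variables `X 1, …, X n` are `m`-dependent under `P`: whenever `t - s > m`, the σ-algebras
generated by `X 1, …, X s` and by `X t, …, X n` are independent. Indices start at `1`; the values
of `X` outside `1, …, n` play no role. -/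
def MDependent (m n : ℕ) (P : Measure Ω) (X : ℕ → Ω → ℕ) : Prop :=
  ∀ s t : ℕ, 1 ≤ s → s + m < t → t ≤ n →
    Indep (⨆ i ∈ Set.Icc 1 s, MeasurableSpace.comap (X i) ⊤)
      (⨆ i ∈ Set.Icc t n, MeasurableSpace.comap (X i) ⊤) P

/-- First factorial moment `E X₁`. -/
def nu1 (P : Measure Ω) (X : ℕ → Ω → ℕ) : ℝ := ∫ ω, (X 1 ω : ℝ) ∂P

/-- Second factorial moment `E X₁ (X₁ - 1)`. -/
def nu2 (P : Measure Ω) (X : ℕ → Ω → ℕ) : ℝ := ∫ ω, (X 1 ω : ℝ) * ((X 1 ω : ℝ) - 1) ∂P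

/-- The mixed moment `E X_k X_{k+1}`. -/
def mixedMoment (P : Measure Ω) (X : ℕ → Ω → ℕ) (k : ℕ) : ℝ :=
  ∫ ω, (X k ω : ℝ) * (X (k + 1) ω : ℝ) ∂P

/-- `γ = e^{1.5 C₀} max(ν₁², ν₂, E X₁X₂)`. -/
def gam (C₀ : ℝ) (P : Measure Ω) (X : ℕ → Ω → ℕ) : ℝ :=
  Real.exp (1.5 * C₀) * max (nu1 P X ^ 2) (max (nu2 P X) (mixedMoment P X 1))

/-- `y = (x - n ν₁) / (n ν₁)`. -/
def yParam (n : ℕ) (P : Measure Ω) (X : ℕ → Ω → ℕ) (x : ℕ) : ℝ :=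
  ((x : ℝ) - n * nu1 P X) / (n * nu1 P X)

/-- `λ* = ν₁ (1 - ν₁ y / (1 - ν₁))`. -/
def lamStar (n : ℕ) (P : Measure Ω) (X : ℕ → Ω → ℕ) (x : ℕ) : ℝ :=
  nu1 P X * (1 - nu1 P X / (1 - nu1 P X) * yParam n P X x)

/-- `S_n = X₁ + ⋯ + X_n`. -/
def partialSum (n : ℕ) (X : ℕ → Ω → ℕ) (ω : Ω) : ℕ := ∑ k ∈ Finset.Icc 1 n, X k ω

/-- The standing assumptions on one row `X 1, …, X n` and one point `x`. -/
structure Setting (C₀ : ℝ) (n : ℕ) (P : Measure Ω) (X : ℕ → Ω → ℕ) (x : ℕ) : Prop where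
  measurable : ∀ k, 1 ≤ k → k ≤ n → Measurable (X k)
  identDistrib : ∀ k, 1 ≤ k → k ≤ n → IdentDistrib (X k) (X 1) P P
  oneDependent : MDependent 1 n P X
  /-- `E X₁X₂` controls the mixed moment of every pair of neighbours (as it does, with equality,
  for a stationary sequence). -/
  mixedMoment_le : ∀ k, 1 ≤ k → k + 1 ≤ n → mixedMoment P X k ≤ mixedMoment P X 1
  x_pos : 0 < x
  /-- `y` is well defined. -/
  nu1_pos : 0 < nu1 P X
  bounded : ∀ᵐ ω ∂P, (X 1 ω : ℝ) ≤ C₀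
  nu1_small : Real.exp (5 * C₀) * nu1 P X ≤ 0.002
  y_small : |yParam n P X x| ≤ 1 / 10
  nu2_small : nu2 P X ≤ nu1 P X * Real.exp (-(1.5 * C₀)) / 20
  mixed_small : mixedMoment P X 1 ≤ nu1 P X * Real.exp (-(1.5 * C₀)) / 20

end PoissonLD

end

/-!
By the Chen–Stein method, `P(S_n ∈ A)` differs from the mass that the Poisson law of mean `n ν₁`
gives to `A` by at most `(ν₂ + 2 E X₁X₂ + 3 ν₁²) / ν₁ = O(ν₁)`: a variable `X_k` is independent of
the sum of the variables outside its neighbourhood `{k - 1, k, k + 1}`, and the solution of the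
Stein equation has increments at most `1 / (n ν₁)`. Passing from the mean `n ν₁` to `n λ*` costs at
most `|n λ* - n ν₁|`, which is of order `ν₁ |x - n ν₁| = O(√(n ν₁³))`. These are additive errors of
size `o(1)`. Since `x` lies within `O(1)` standard deviations of `n ν₁`, the Poisson tail from `x`
on is bounded below by a positive constant, so that the additive errors become relative ones.
-/

namespace PoissonLD

open scoped NNReal Nat
open Real Set

section Poisson

variable {r s : ℝ≥0}

lemma hasSum_indicator_measureReal_singleton {α : Type*} [MeasurableSpace α] [Countable α]
    [MeasurableSingletonClass α] (μ : Measure α) [IsFiniteMeasure μ] (A : Set α) :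
    HasSum (A.indicator fun a => μ.real {a}) (μ.real A) := by
  have hA : ∑' a, A.indicator (fun a => μ {a}) a = μ A :=
    Measure.tsum_indicator_apply_singleton μ A A.to_countable.measurableSet
  have hsum := ENNReal.hasSum_toReal (hA ▸ measure_ne_top μ A)
  rw [← ENNReal.tsum_toReal_eq fun a => ne_top_of_le_ne_top (measure_ne_top μ {a})
    (indicator_le_self' (by simp) a), hA] at hsum
  refine hsum.congr_fun fun a => ?_
  by_cases ha : a ∈ A <;> simp [ha, measureReal_def]

lemma succ_mul_poissonMeasure_real_singleton (r : ℝ≥0) (k : ℕ) :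
    ((k : ℝ) + 1) * Po(r).real {k + 1} = r * Po(r).real {k} := by
  simp only [poissonMeasure_real_singleton, Nat.factorial_succ, pow_succ, Nat.cast_mul,
    Nat.cast_add, Nat.cast_one]
  field_simp

lemma hasSum_poissonMeasure_mul_natCast_mul {g : ℕ → ℝ} {a : ℝ}
    (hg : HasSum (fun k => Po(r).real {k} * g (k + 1)) a) :
    HasSum (fun k => Po(r).real {k} * (k * g k)) (r * a) := by
  rw [← hasSum_nat_add_iff' 1]
  simp only [Finset.range_one, Finset.sum_singleton, Nat.cast_zero, zero_mul, mul_zero, sub_zero]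
  refine (hg.mul_left (r : ℝ)).congr_fun fun k => ?_
  push_cast
  linear_combination g (k + 1) * succ_mul_poissonMeasure_real_singleton r k

lemma hasSum_poissonMeasure_real_singleton (r : ℝ≥0) :
    HasSum (fun k => Po(r).real {k}) 1 := by
  simpa using hasSum_indicator_measureReal_singleton Po(r) univ

lemma hasSum_poissonMeasure_mean (r : ℝ≥0) :
    HasSum (fun k : ℕ => Po(r).real {k} * k) r := by
  simpa only [Pi.one_apply, mul_one] using
    hasSum_poissonMeasure_mul_natCast_mul (r := r) (g := 1) (a := 1)
      (by simpa using hasSum_poissonMeasure_real_singleton r)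

lemma hasSum_poissonMeasure_variance (r : ℝ≥0) :
    HasSum (fun k : ℕ => Po(r).real {k} * ((k : ℝ) - r) ^ 2) r := by
  have hsq : HasSum (fun k : ℕ => Po(r).real {k} * (k * k)) (r * (r + 1)) := by
    refine hasSum_poissonMeasure_mul_natCast_mul (g := fun k => k) ?_
    refine ((hasSum_poissonMeasure_mean r).add
      (hasSum_poissonMeasure_real_singleton r)).congr_fun fun k => ?_
    push_cast
    ring
  have hvar := (hsq.sub ((hasSum_poissonMeasure_mean r).mul_left (2 * (r : ℝ)))).add
    ((hasSum_poissonMeasure_real_singleton r).mul_left ((r : ℝ) ^ 2))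
  convert! hvar using 1
  · ext k
    ring
  · ring

lemma sq_mul_poissonMeasure_real_Iio_le {x : ℕ} (hx : (x : ℝ) ≤ r) :
    ((r : ℝ) - x) ^ 2 * Po(r).real (Iio x) ≤ r := by
  refine hasSum_le (fun k => ?_)
    ((hasSum_indicator_measureReal_singleton Po(r) (Iio x)).mul_left (((r : ℝ) - x) ^ 2))
    (hasSum_poissonMeasure_variance r)
  by_cases hk : k < x
  · have hkx : (k : ℝ) ≤ x := mod_cast hk.le
    rw [indicator_of_mem (mem_Iio.2 hk), mul_comm, ← sq_abs ((k : ℝ) - r),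
      abs_of_nonpos (by linarith)]
    gcongr
    linarith
  · rw [indicator_of_notMem (by simpa using hk), mul_zero]
    positivity

lemma poissonMeasure_real_Ioi_succ_le (r : ℝ≥0) (k : ℕ) :
    ((k : ℝ) + 2) * Po(r).real (Ioi (k + 1)) ≤ r * Po(r).real (Ioi k) := by
  have hshift : HasSum (fun j => Po(r).real {j} * (Ioi (k + 1)).indicator 1 (j + 1))
      (Po(r).real (Ioi k)) :=
    (hasSum_indicator_measureReal_singleton Po(r) (Ioi k)).congr_fun fun j => by
      simp [indicator_apply]
  refine hasSum_le (fun j => ?_)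
    ((hasSum_indicator_measureReal_singleton Po(r) (Ioi (k + 1))).mul_left ((k : ℝ) + 2))
    (hasSum_poissonMeasure_mul_natCast_mul hshift)
  by_cases hj : k + 1 < j
  · have hkj : (k : ℝ) + 2 ≤ j := mod_cast hj
    simp only [indicator_of_mem (mem_Ioi.2 hj), Pi.one_apply, mul_one]
    rw [mul_comm]
    gcongr
  · simp [hj]

lemma mul_poissonMeasure_real_Iic_le (r : ℝ≥0) (k : ℕ) :
    r * Po(r).real (Iic k) ≤ ((k : ℝ) + 1) * Po(r).real (Iic (k + 1)) := by
  have hshift : HasSum (fun j => Po(r).real {j} * (Iic (k + 1)).indicator 1 (j + 1))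
      (Po(r).real (Iic k)) :=
    (hasSum_indicator_measureReal_singleton Po(r) (Iic k)).congr_fun fun j => by
      simp [indicator_apply]
  refine hasSum_le (fun j => ?_) (hasSum_poissonMeasure_mul_natCast_mul hshift)
    ((hasSum_indicator_measureReal_singleton Po(r) (Iic (k + 1))).mul_left ((k : ℝ) + 1))
  by_cases hj : j ≤ k + 1
  · have hkj : (j : ℝ) ≤ k + 1 := mod_cast hj
    simp only [indicator_of_mem (mem_Iic.2 hj), Pi.one_apply, mul_one]
    rw [mul_comm]
    gcongr
  · simp [hj]

lemma antitone_poissonMeasure_real_Ioi_div (hr : 0 < r) :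
    Antitone fun k => Po(r).real (Ioi k) / Po(r).real {k} := by
  refine antitone_nat_of_succ_le fun k => ?_
  have hk := poissonMeasure_real_singleton_pos k hr
  have hr' : (0 : ℝ) < r := hr
  rw [div_le_div_iff₀ (poissonMeasure_real_singleton_pos _ hr) hk]
  refine le_of_mul_le_mul_left ?_ hr'
  calc r * (Po(r).real (Ioi (k + 1)) * Po(r).real {k})
      = (k + 1) * Po(r).real (Ioi (k + 1)) * Po(r).real {k + 1} := by
        linear_combination -Po(r).real (Ioi (k + 1)) * succ_mul_poissonMeasure_real_singleton r k
    _ ≤ (k + 2) * Po(r).real (Ioi (k + 1)) * Po(r).real {k + 1} := by gcongr; norm_num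
    _ ≤ r * Po(r).real (Ioi k) * Po(r).real {k + 1} := by
        exact mul_le_mul_of_nonneg_right (poissonMeasure_real_Ioi_succ_le r k) measureReal_nonneg
    _ = r * (Po(r).real (Ioi k) * Po(r).real {k + 1}) := mul_assoc _ _ _

lemma monotone_poissonMeasure_real_Iic_div (hr : 0 < r) :
    Monotone fun k => Po(r).real (Iic k) / Po(r).real {k} := by
  refine monotone_nat_of_le_succ fun k => ?_
  rw [div_le_div_iff₀ (poissonMeasure_real_singleton_pos k hr)
    (poissonMeasure_real_singleton_pos _ hr)]
  have hk : (0 : ℝ) < k + 1 := by positivity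
  refine le_of_mul_le_mul_left ?_ hk
  calc (k + 1) * (Po(r).real (Iic k) * Po(r).real {k + 1})
      = r * Po(r).real (Iic k) * Po(r).real {k} := by
        linear_combination Po(r).real (Iic k) * succ_mul_poissonMeasure_real_singleton r k
    _ ≤ (k + 1) * Po(r).real (Iic (k + 1)) * Po(r).real {k} := by
        exact mul_le_mul_of_nonneg_right (mul_poissonMeasure_real_Iic_le r k) measureReal_nonneg
    _ = (k + 1) * (Po(r).real (Iic (k + 1)) * Po(r).real {k}) := mul_assoc _ _ _

lemma exp_neg_sub_mul_poissonMeasure_real_le (hsr : s ≤ r) (A : Set ℕ) :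
    exp (-((r : ℝ) - s)) * Po(s).real A ≤ Po(r).real A := by
  refine hasSum_le (fun k => ?_) ((hasSum_indicator_measureReal_singleton Po(s) A).mul_left _)
    (hasSum_indicator_measureReal_singleton Po(r) A)
  by_cases hk : k ∈ A
  · simp only [indicator_of_mem hk, poissonMeasure_real_singleton]
    calc exp (-((r : ℝ) - s)) * (exp (-s) * s ^ k / k !)
        = exp (-r) * s ^ k / k ! := by
          rw [mul_div_assoc, mul_div_assoc, ← mul_assoc, ← exp_add]
          ring_nf
      _ ≤ exp (-r) * r ^ k / k ! := by gcongr
  · simp [hk]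

lemma abs_poissonMeasure_real_sub_le (r s : ℝ≥0) (A : Set ℕ) :
    |Po(r).real A - Po(s).real A| ≤ |(r : ℝ) - s| := by
  wlog hsr : s ≤ r generalizing r s
  · rw [abs_sub_comm, abs_sub_comm (r : ℝ)]
    exact this s r (le_of_not_ge hsr)
  have hdrop : ∀ B : Set ℕ, Po(s).real B - ((r : ℝ) - s) ≤ Po(r).real B := fun B => by
    have hd : (0 : ℝ) ≤ r - s := sub_nonneg.2 hsr
    calc Po(s).real B - ((r : ℝ) - s)
        ≤ (1 - ((r : ℝ) - s)) * Po(s).real B := by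
          linarith [mul_le_of_le_one_right hd (measureReal_le_one (μ := Po(s)) (s := B))]
      _ ≤ exp (-((r : ℝ) - s)) * Po(s).real B := by
          gcongr
          exact one_sub_le_exp_neg _
      _ ≤ Po(r).real B := exp_neg_sub_mul_poissonMeasure_real_le hsr B
  have hA := hdrop A
  have hAc := hdrop Aᶜ
  rw [probReal_compl_eq_one_sub .of_discrete, probReal_compl_eq_one_sub .of_discrete] at hAc
  rw [abs_of_nonneg (sub_nonneg.2 (NNReal.coe_le_coe.2 hsr)), abs_le]
  constructor <;> linarith

lemma sq_poissonMeasure_real_singleton (hr : 0 < r) (s : ℝ≥0) (k : ℕ) :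
    Po(s).real {k} ^ 2 =
      exp (((s : ℝ) - r) ^ 2 / r) * Po(s ^ 2 / r).real {k} * Po(r).real {k} := by
  have hr' : (r : ℝ) ≠ 0 := (NNReal.coe_pos.2 hr).ne'
  have hexp : exp (-(s : ℝ)) ^ 2 =
      exp (((s : ℝ) - r) ^ 2 / r) * exp (-((s : ℝ) ^ 2 / r)) * exp (-(r : ℝ)) := by
    rw [← exp_add, ← exp_add, ← exp_nat_mul]
    congr 1
    push_cast
    field_simp
    ring
  simp only [poissonMeasure_real_singleton, NNReal.coe_div, NNReal.coe_pow]
  rw [div_pow, mul_pow, hexp, div_pow]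
  field_simp
  ring

-- Cauchy–Schwarz for the likelihood ratio of `Po(s)` against `Po(r)`.
lemma sq_poissonMeasure_real_le (hr : 0 < r) (s : ℝ≥0) (A : Set ℕ) :
    Po(s).real A ^ 2 ≤ exp (((s : ℝ) - r) ^ 2 / r) * Po(r).real A := by
  have hsum (q : ℝ≥0) := hasSum_indicator_measureReal_singleton Po(q) A
  have hnonneg (q : ℝ≥0) (k : ℕ) : 0 ≤ A.indicator (fun k => Po(q).real {k}) k :=
    indicator_nonneg (fun _ _ => measureReal_nonneg) k
  calc Po(s).real A ^ 2
      ≤ exp (((s : ℝ) - r) ^ 2 / r) * Po(s ^ 2 / r).real A * Po(r).real A :=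
        le_of_tendsto_of_tendsto' (Tendsto.pow (hsum s) 2)
          (Tendsto.mul ((hsum (s ^ 2 / r)).mul_left _) (hsum r)) fun F =>
            Finset.sum_sq_le_sum_mul_sum_of_sq_le_mul F
              (fun k _ => mul_nonneg (exp_pos _).le (hnonneg _ k)) (fun k _ => hnonneg r k)
              fun k _ => by
                by_cases hk : k ∈ A
                · simpa only [indicator_of_mem hk] using
                    (sq_poissonMeasure_real_singleton hr s k).le
                · simp [hk]
    _ ≤ exp (((s : ℝ) - r) ^ 2 / r) * 1 * Po(r).real A := by
        gcongr
        exact measureReal_le_one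
    _ = exp (((s : ℝ) - r) ^ 2 / r) * Po(r).real A := by rw [mul_one]

lemma half_le_poissonMeasure_real_Ici {x : ℕ} (hxr : (x : ℝ) < r)
    (hvar : 2 * (r : ℝ) ≤ ((r : ℝ) - x) ^ 2) : 1 / 2 ≤ Po(r).real (Ici x) := by
  have hsq : 0 < ((r : ℝ) - x) ^ 2 := pow_pos (sub_pos.2 hxr) 2
  have hIio : Po(r).real (Iio x) ≤ 1 / 2 := by
    refine le_of_mul_le_mul_left ?_ hsq
    linarith [sq_mul_poissonMeasure_real_Iio_le hxr.le]
  rw [← compl_Iio, probReal_compl_eq_one_sub .of_discrete]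
  linarith

lemma one_le_mul_sqrt_of_le_add_mul_sqrt {x : ℕ} {l B : ℝ} (hx : 0 < x) (hl : 0 ≤ l)
    (hB : 0 ≤ B) (h : (x : ℝ) ≤ l + B * √l) : 1 ≤ (B + 1) * √l := by
  have hx1 : (1 : ℝ) ≤ x := mod_cast hx
  rcases le_total 1 √l with hl1 | hl1
  · exact one_le_mul_of_one_le_of_one_le (by linarith) hl1
  · have hll : l ≤ √l := by
      nlinarith [sq_sqrt hl, sqrt_nonneg l]
    linarith

-- Shift the rate up by a multiple of the standard deviation, so that `Ici x` has mass at least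
-- `1 / 2`, and then change the measure back.
lemma exists_pos_le_poissonMeasure_real_Ici {B : ℝ} (hB : 0 ≤ B) :
    ∃ c : ℝ, 0 < c ∧ ∀ (r : ℝ≥0) (x : ℕ), (x : ℝ) ≤ r + B * √r → c ≤ Po(r).real (Ici x) := by
  set b := B + 4 * (B + 1) with hb
  refine ⟨exp (-b ^ 2) / 4, by positivity, fun r x hx => ?_⟩
  rcases x.eq_zero_or_pos with rfl | hx0
  · have hexp : exp (-b ^ 2) ≤ 1 := exp_le_one_iff.2 (by nlinarith)
    simp only [← bot_eq_zero, Ici_bot, probReal_univ]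
    linarith
  have hroot : 1 ≤ (B + 1) * √r := one_le_mul_sqrt_of_le_add_mul_sqrt hx0 r.2 hB hx
  have hroot_pos : 0 < √(r : ℝ) := by
    by_contra! hle
    nlinarith
  have hr : 0 < r := NNReal.coe_pos.1 (sqrt_pos.1 hroot_pos)
  have hsq : √(r : ℝ) ^ 2 = r := sq_sqrt r.2
  obtain ⟨s, hs⟩ : ∃ s : ℝ≥0, (s : ℝ) = r + b * √r := ⟨⟨r + b * √r, by positivity⟩, rfl⟩
  have hgap : 4 * ((B + 1) * √r) ≤ s - x := by
    rw [hs, hb]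
    linarith
  have hhalf : 1 / 2 ≤ Po(s).real (Ici x) := by
    refine half_le_poissonMeasure_real_Ici (by linarith) ?_
    calc 2 * (s : ℝ) ≤ (4 * ((B + 1) * √r)) ^ 2 := by
          rw [hs, hb]
          nlinarith [mul_le_mul_of_nonneg_left hroot (by positivity : 0 ≤ b * √r)]
      _ ≤ ((s : ℝ) - x) ^ 2 := by gcongr
  have hmass := sq_poissonMeasure_real_le hr s (Ici x)
  have hexponent : ((s : ℝ) - r) ^ 2 / r = b ^ 2 := by
    rw [hs, add_sub_cancel_left, mul_pow, hsq, mul_div_cancel_right₀ _ (NNReal.coe_pos.2 hr).ne']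
  rw [hexponent] at hmass
  have hquarter : 1 / 4 ≤ exp (b ^ 2) * Po(r).real (Ici x) := by nlinarith
  calc exp (-b ^ 2) / 4 = exp (-b ^ 2) * (1 / 4) := by ring
    _ ≤ exp (-b ^ 2) * (exp (b ^ 2) * Po(r).real (Ici x)) := by gcongr
    _ = Po(r).real (Ici x) := by rw [← mul_assoc, ← exp_add]; simp

/-- The solution `f` of the Stein equation `r * f (k + 1) - k * f k = 1_A k - Po(r) A` of the
Poisson distribution, written with the mass on the initial segment `Iic k`. The equation leaves
`f 0` free; it is set to `0`. -/
noncomputable def steinSolution (r : ℝ≥0) (A : Set ℕ) : ℕ → ℝ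
  | 0 => 0
  | k + 1 => (Po(r).real (A ∩ Iic k) - Po(r).real A * Po(r).real (Iic k)) / (r * Po(r).real {k})

lemma measureReal_inter_Iic_succ (μ : Measure ℕ) [IsFiniteMeasure μ] (A : Set ℕ) (k : ℕ) :
    μ.real (A ∩ Iic (k + 1)) =
      μ.real (A ∩ Iic k) + A.indicator 1 (k + 1) * μ.real {k + 1} := by
  rw [← Order.succ_eq_add_one, Order.Iic_succ]
  by_cases hk : k + 1 ∈ A
  · rw [Order.succ_eq_add_one, inter_insert_of_mem hk, ← union_singleton,
      measureReal_union (by simp) .of_discrete]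
    simp [hk]
  · rw [Order.succ_eq_add_one, inter_insert_of_notMem hk]
    simp [hk]

lemma measureReal_inter_Iic_add_inter_Ioi (μ : Measure ℕ) [IsFiniteMeasure μ] (A : Set ℕ) (k : ℕ) :
    μ.real (A ∩ Iic k) + μ.real (A ∩ Ioi k) = μ.real A := by
  rw [← compl_Iic, ← sdiff_eq]
  exact measureReal_inter_add_sdiff .of_discrete

lemma steinSolution_one (hr : 0 < r) (A : Set ℕ) :
    r * steinSolution r A 1 = A.indicator 1 0 - Po(r).real A := by
  have hw := (poissonMeasure_real_singleton_pos 0 hr).ne'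
  have hr' : (r : ℝ) ≠ 0 := (NNReal.coe_pos.2 hr).ne'
  have hA : Po(r).real (A ∩ {0}) = A.indicator 1 0 * Po(r).real {0} := by
    by_cases h0 : 0 ∈ A <;> simp [h0]
  rw [steinSolution, ← bot_eq_zero, Iic_bot, bot_eq_zero, hA]
  field_simp

lemma steinSolution_equation (hr : 0 < r) (A : Set ℕ) (k : ℕ) :
    r * steinSolution r A (k + 1) - k * steinSolution r A k =
      A.indicator 1 k - Po(r).real A := by
  have hr' : (r : ℝ) ≠ 0 := (NNReal.coe_pos.2 hr).ne'
  cases k with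
  | zero => simpa using steinSolution_one hr A
  | succ k =>
    have hIic := measureReal_inter_Iic_succ Po(r) univ k
    simp only [univ_inter, indicator_univ, Pi.one_apply, one_mul] at hIic
    have hw := (poissonMeasure_real_singleton_pos k hr).ne'
    have hw_succ := (poissonMeasure_real_singleton_pos (k + 1) hr).ne'
    simp only [steinSolution]
    rw [← succ_mul_poissonMeasure_real_singleton r k, measureReal_inter_Iic_succ, hIic]
    push_cast
    field_simp
    ring

lemma steinSolution_compl (r : ℝ≥0) (A : Set ℕ) (k : ℕ) :
    steinSolution r Aᶜ k = -steinSolution r A k := by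
  cases k with
  | zero => simp [steinSolution]
  | succ k =>
    have hsplit : Po(r).real (A ∩ Iic k) + Po(r).real (Aᶜ ∩ Iic k) = Po(r).real (Iic k) := by
      rw [inter_comm, inter_comm Aᶜ, ← sdiff_eq]
      exact measureReal_inter_add_sdiff .of_discrete
    rw [steinSolution, steinSolution, probReal_compl_eq_one_sub .of_discrete, ← hsplit]
    ring

lemma steinSolution_succ (hr : 0 < r) (A : Set ℕ) (k : ℕ) :
    r * steinSolution r A (k + 1) =
      Po(r).real (A ∩ Iic k) * (Po(r).real (Ioi k) / Po(r).real {k}) -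
        Po(r).real (A ∩ Ioi k) * (Po(r).real (Iic k) / Po(r).real {k}) := by
  have hr' : (r : ℝ) ≠ 0 := (NNReal.coe_pos.2 hr).ne'
  have hw := (poissonMeasure_real_singleton_pos k hr).ne'
  have hIoi : Po(r).real (Ioi k) = 1 - Po(r).real (Iic k) := by
    rw [← compl_Iic, probReal_compl_eq_one_sub .of_discrete]
  rw [steinSolution, hIoi]
  field_simp
  rw [← measureReal_inter_Iic_add_inter_Ioi Po(r) A k]
  ring

lemma mul_steinSolution_succ_sub_le_one (hr : 0 < r) (A : Set ℕ) (k : ℕ) :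
    r * (steinSolution r A (k + 1) - steinSolution r A k) ≤ 1 := by
  cases k with
  | zero =>
    rw [steinSolution, sub_zero, steinSolution_one hr]
    have hA : A.indicator (1 : ℕ → ℝ) 0 ≤ 1 := indicator_le_self' (by simp) 0
    linarith [measureReal_nonneg (μ := Po(r)) (s := A)]
  | succ k =>
    set R := fun j => Po(r).real (Ioi j) / Po(r).real {j}
    set L := fun j => Po(r).real (Iic j) / Po(r).real {j}
    have hR : R (k + 1) ≤ R k := antitone_poissonMeasure_real_Ioi_div hr k.le_succ
    have hL : L k ≤ L (k + 1) := monotone_poissonMeasure_real_Iic_div hr k.le_succ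
    have hRL : Po(r).real {k + 1} * (R (k + 1) + L (k + 1)) = 1 := by
      rw [← add_div, mul_div_cancel₀ _ (poissonMeasure_real_singleton_pos (k + 1) hr).ne',
        ← compl_Iic, probReal_compl_eq_one_sub .of_discrete]
      ring
    have hsplit := measureReal_inter_Iic_add_inter_Ioi Po(r) A k
    rw [← measureReal_inter_Iic_add_inter_Ioi Po(r) A (k + 1),
      measureReal_inter_Iic_succ] at hsplit
    have hA : A.indicator (1 : ℕ → ℝ) (k + 1) ≤ 1 := indicator_le_self' (by simp) _
    calc r * (steinSolution r A (k + 1 + 1) - steinSolution r A (k + 1))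
        = A.indicator 1 (k + 1) * (Po(r).real {k + 1} * (R (k + 1) + L k)) +
            Po(r).real (A ∩ Iic k) * (R (k + 1) - R k) +
            Po(r).real (A ∩ Ioi (k + 1)) * (L k - L (k + 1)) := by
          rw [mul_sub, steinSolution_succ hr, steinSolution_succ hr, measureReal_inter_Iic_succ]
          linear_combination L k * hsplit
      _ ≤ 1 * (Po(r).real {k + 1} * (R (k + 1) + L (k + 1))) + 0 + 0 := by
          gcongr
          · exact mul_nonpos_of_nonneg_of_nonpos measureReal_nonneg (sub_nonpos.2 hR)
          · exact mul_nonpos_of_nonneg_of_nonpos measureReal_nonneg (sub_nonpos.2 hL)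
      _ = 1 := by rw [hRL]; norm_num

lemma abs_steinSolution_succ_sub_le (hr : 0 < r) (A : Set ℕ) (k : ℕ) :
    |steinSolution r A (k + 1) - steinSolution r A k| ≤ (r : ℝ)⁻¹ := by
  have hr' : (0 : ℝ) < r := hr
  have hA := mul_steinSolution_succ_sub_le_one hr A k
  have hAc := mul_steinSolution_succ_sub_le_one hr Aᶜ k
  rw [steinSolution_compl, steinSolution_compl] at hAc
  rw [abs_sub_le_iff, ← one_div, le_div_iff₀' hr', le_div_iff₀' hr']
  exact ⟨hA, by linarith⟩

end Poisson

section ChenStein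

variable {Ω : Type*} [MeasurableSpace Ω] {μ : Measure Ω} {f : ℕ → ℝ} {K : ℝ}

lemma abs_sub_le_mul_of_abs_succ_sub_le (hf : ∀ k, |f (k + 1) - f k| ≤ K) (a d : ℕ) :
    |f (a + d) - f a| ≤ K * d := by
  have hdist : dist (f a) (f (a + d)) ≤ ∑ _k ∈ Finset.Ico a (a + d), K :=
    dist_le_Ico_sum_of_dist_le (Nat.le_add_right a d) fun {k} _ _ => by
      rw [dist_comm, Real.dist_eq]
      exact hf k
  rw [dist_comm, Real.dist_eq] at hdist
  simpa [mul_comm] using hdist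

lemma abs_natCast_mul_sub_le (hf : ∀ k, |f (k + 1) - f k| ≤ K) (w y z : ℕ) :
    |(y : ℝ) * f (w + y + z) - y * f (w + 1)| ≤ K * ((y : ℝ) * (y - 1) + y * z) := by
  rcases y with _ | y
  · simp
  · have hincr := abs_sub_le_mul_of_abs_succ_sub_le hf (w + 1) (y + z)
    rw [← mul_sub, abs_mul, Nat.abs_cast, show w + (y + 1) + z = w + 1 + (y + z) by ring]
    calc ((y + 1 : ℕ) : ℝ) * |f (w + 1 + (y + z)) - f (w + 1)|
        ≤ ((y + 1 : ℕ) : ℝ) * (K * ((y + z : ℕ) : ℝ)) := by gcongr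
      _ = K * (((y + 1 : ℕ) : ℝ) * (((y + 1 : ℕ) : ℝ) - 1) + ((y + 1 : ℕ) : ℝ) * z) := by
        push_cast
        ring

lemma memLp_comp_of_abs_succ_sub_le [IsFiniteMeasure μ] (hf : ∀ k, |f (k + 1) - f k| ≤ K)
    {S : Ω → ℕ} (hS : Measurable S) {p : ENNReal} (hS_memLp : MemLp (fun ω => (S ω : ℝ)) p μ) :
    MemLp (fun ω => f (S ω)) p μ := by
  refine ((memLp_const |f 0|).add (hS_memLp.const_mul K)).mono
    (Measurable.of_discrete.comp hS).aestronglyMeasurable (ae_of_all _ fun ω => ?_)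
  have hincr := abs_sub_le_mul_of_abs_succ_sub_le hf 0 (S ω)
  rw [zero_add] at hincr
  calc ‖f (S ω)‖ ≤ |f 0| + |f (S ω) - f 0| := by
        rw [Real.norm_eq_abs]
        linarith [abs_sub_abs_le_abs_sub (f (S ω)) (f 0)]
    _ ≤ |f 0| + K * S ω := by gcongr
    _ ≤ ‖|f 0| + K * S ω‖ := Real.le_norm_self _

lemma abs_integral_sub_integral_le {g h b : Ω → ℝ} (hg : Integrable g μ) (hh : Integrable h μ)
    (hb : Integrable b μ) (hle : ∀ ω, |g ω - h ω| ≤ b ω) :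
    |∫ ω, g ω ∂μ - ∫ ω, h ω ∂μ| ≤ ∫ ω, b ω ∂μ := by
  rw [← integral_sub hg hh]
  exact norm_integral_le_of_norm_le (f := fun ω => g ω - h ω) hb (ae_of_all μ hle)

lemma abs_integral_comp_add_sub_le [IsFiniteMeasure μ] (hf : ∀ k, |f (k + 1) - f k| ≤ K)
    {W D : Ω → ℕ} (hW : Measurable W) (hD : Measurable D)
    (hW_int : Integrable (fun ω => (W ω : ℝ)) μ) (hD_int : Integrable (fun ω => (D ω : ℝ)) μ) :
    |∫ ω, f (W ω + D ω) ∂μ - ∫ ω, f (W ω) ∂μ| ≤ K * ∫ ω, (D ω : ℝ) ∂μ := by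
  rw [← integral_const_mul]
  have hWD : MemLp (fun ω => ((W ω + D ω : ℕ) : ℝ)) 1 μ := by
    simp only [Nat.cast_add]
    exact memLp_one_iff_integrable.2 (hW_int.add hD_int)
  refine abs_integral_sub_integral_le ?_ ?_ (hD_int.const_mul K)
    fun ω => abs_sub_le_mul_of_abs_succ_sub_le hf (W ω) (D ω)
  · exact memLp_one_iff_integrable.1 (memLp_comp_of_abs_succ_sub_le hf (hW.add hD) hWD)
  · exact memLp_one_iff_integrable.1
      (memLp_comp_of_abs_succ_sub_le hf hW (memLp_one_iff_integrable.2 hW_int))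

lemma abs_integral_mul_comp_add_sub_le [IsFiniteMeasure μ] (hf : ∀ k, |f (k + 1) - f k| ≤ K)
    {W Y Z : Ω → ℕ} (hW : Measurable W) (hY : Measurable Y) (hZ : Measurable Z)
    (hW_memLp : MemLp (fun ω => (W ω : ℝ)) 2 μ) (hY_memLp : MemLp (fun ω => (Y ω : ℝ)) 2 μ)
    (hZ_memLp : MemLp (fun ω => (Z ω : ℝ)) 2 μ) :
    |∫ ω, (Y ω : ℝ) * f (W ω + Y ω + Z ω) ∂μ - ∫ ω, (Y ω : ℝ) * f (W ω + 1) ∂μ| ≤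
      K * (∫ ω, (Y ω : ℝ) * (Y ω - 1) ∂μ + ∫ ω, (Y ω : ℝ) * Z ω ∂μ) := by
  have hS_memLp : MemLp (fun ω => ((W ω + Y ω + Z ω : ℕ) : ℝ)) 2 μ := by
    simp only [Nat.cast_add]
    exact (hW_memLp.add hY_memLp).add hZ_memLp
  have hfS : MemLp (fun ω => f (W ω + Y ω + Z ω)) 2 μ :=
    memLp_comp_of_abs_succ_sub_le hf ((hW.add hY).add hZ) hS_memLp
  have hfW : MemLp (fun ω => f (W ω + 1)) 2 μ :=
    memLp_comp_of_abs_succ_sub_le (f := fun k => f (k + 1)) (fun k => hf (k + 1)) hW hW_memLp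
  have hYY : Integrable (fun ω => (Y ω : ℝ) * (Y ω - 1)) μ :=
    hY_memLp.integrable_mul (hY_memLp.sub (memLp_const 1))
  have hYZ : Integrable (fun ω => (Y ω : ℝ) * Z ω) μ := hY_memLp.integrable_mul hZ_memLp
  rw [← integral_add hYY hYZ, ← integral_const_mul]
  exact abs_integral_sub_integral_le (hY_memLp.integrable_mul hfS) (hY_memLp.integrable_mul hfW)
    ((hYY.add hYZ).const_mul K) fun ω => abs_natCast_mul_sub_le hf _ _ _

-- Both expectations are compared with their values at `W + 1`, where independence factorises.
lemma abs_integral_mul_sub_mul_integral_le [IsFiniteMeasure μ]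
    (hf : ∀ k, |f (k + 1) - f k| ≤ K) {W Y Z : Ω → ℕ} (hW : Measurable W) (hY : Measurable Y)
    (hZ : Measurable Z) (hW_memLp : MemLp (fun ω => (W ω : ℝ)) 2 μ)
    (hY_memLp : MemLp (fun ω => (Y ω : ℝ)) 2 μ) (hZ_memLp : MemLp (fun ω => (Z ω : ℝ)) 2 μ)
    (hYW : IndepFun Y W μ) :
    |(∫ ω, (Y ω : ℝ) ∂μ) * ∫ ω, f (W ω + Y ω + Z ω + 1) ∂μ -
        ∫ ω, (Y ω : ℝ) * f (W ω + Y ω + Z ω) ∂μ| ≤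
      K * (∫ ω, (Y ω : ℝ) * (Y ω - 1) ∂μ + ∫ ω, (Y ω : ℝ) * Z ω ∂μ +
        (∫ ω, (Y ω : ℝ) ∂μ) * (∫ ω, (Y ω : ℝ) ∂μ + ∫ ω, (Z ω : ℝ) ∂μ)) := by
  have hY_int := hY_memLp.integrable one_le_two
  have hZ_int := hZ_memLp.integrable one_le_two
  have hfactor : ∫ ω, (Y ω : ℝ) * f (W ω + 1) ∂μ =
      (∫ ω, (Y ω : ℝ) ∂μ) * ∫ ω, f (W ω + 1) ∂μ :=
    hYW.integral_fun_comp_mul_comp (f := fun k : ℕ => (k : ℝ)) (g := fun k => f (k + 1))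
      hY.aemeasurable hW.aemeasurable (by fun_prop) (by fun_prop)
  have hlocal := abs_integral_mul_comp_add_sub_le hf hW hY hZ hW_memLp hY_memLp hZ_memLp
  have hremove : |∫ ω, f (W ω + Y ω + Z ω + 1) ∂μ - ∫ ω, f (W ω + 1) ∂μ| ≤
      K * (∫ ω, (Y ω : ℝ) ∂μ + ∫ ω, (Z ω : ℝ) ∂μ) := by
    have hYZ_int : Integrable (fun ω => ((Y ω + Z ω : ℕ) : ℝ)) μ := by
      simp only [Nat.cast_add]
      exact hY_int.add hZ_int
    have hadd := abs_integral_comp_add_sub_le (f := fun k => f (k + 1)) (fun k => hf (k + 1))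
      hW (hY.add hZ) (hW_memLp.integrable one_le_two) hYZ_int
    simpa only [Nat.cast_add, Pi.add_apply, ← add_assoc, integral_add hY_int hZ_int] using hadd
  have hY_nonneg : 0 ≤ ∫ ω, (Y ω : ℝ) ∂μ := integral_nonneg fun ω => Nat.cast_nonneg _
  rw [hfactor] at hlocal
  have hproduct := mul_le_mul_of_nonneg_left hremove hY_nonneg
  rw [← abs_of_nonneg hY_nonneg, ← abs_mul, abs_of_nonneg hY_nonneg, mul_sub] at hproduct
  rw [abs_le] at hlocal hproduct ⊢
  constructor <;> linarith [hlocal.1, hlocal.2, hproduct.1, hproduct.2]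

lemma integral_steinSolution_equation [IsProbabilityMeasure μ] {r : ℝ≥0} (hr : 0 < r)
    {S : Ω → ℕ} (hS : Measurable S) (hS_memLp : MemLp (fun ω => (S ω : ℝ)) 2 μ) (A : Set ℕ) :
    r * ∫ ω, steinSolution r A (S ω + 1) ∂μ - ∫ ω, (S ω : ℝ) * steinSolution r A (S ω) ∂μ =
      μ.real (S ⁻¹' A) - Po(r).real A := by
  have hincr := abs_steinSolution_succ_sub_le hr A
  have hf_succ : Integrable (fun ω => steinSolution r A (S ω + 1)) μ :=
    (memLp_comp_of_abs_succ_sub_le (f := fun k => steinSolution r A (k + 1))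
      (fun k => hincr (k + 1)) hS hS_memLp).integrable one_le_two
  have hf : Integrable (fun ω => (S ω : ℝ) * steinSolution r A (S ω)) μ :=
    hS_memLp.integrable_mul (memLp_comp_of_abs_succ_sub_le hincr hS hS_memLp)
  have hA : MeasurableSet (S ⁻¹' A) := hS .of_discrete
  rw [← integral_const_mul, ← integral_sub (hf_succ.const_mul _) hf]
  simp only [steinSolution_equation hr]
  calc ∫ ω, (A.indicator 1 (S ω) - Po(r).real A) ∂μ
      = ∫ ω, (S ⁻¹' A).indicator 1 ω ∂μ - ∫ _, Po(r).real A ∂μ :=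
        integral_sub ((integrable_indicator_iff hA).2 (integrable_const (1 : ℝ)).integrableOn)
          (integrable_const _)
    _ = μ.real (S ⁻¹' A) - Po(r).real A := by simp [integral_indicator_one hA]

theorem abs_measureReal_sum_sub_poissonMeasure_le [IsProbabilityMeasure μ] {ι : Type*}
    [DecidableEq ι] {s : Finset ι} {N : ι → Finset ι} {X : ι → Ω → ℕ} {r : ℝ≥0} (hr : 0 < r)
    (hX : ∀ i ∈ s, Measurable (X i)) (hX_memLp : ∀ i ∈ s, MemLp (fun ω => (X i ω : ℝ)) 2 μ)
    (hN : ∀ i ∈ s, N i ⊆ s.erase i)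
    (hindep : ∀ i ∈ s, IndepFun (X i) (fun ω => ∑ j ∈ s.erase i \ N i, X j ω) μ)
    (hmean : (r : ℝ) = ∑ i ∈ s, ∫ ω, (X i ω : ℝ) ∂μ) (A : Set ℕ) :
    |μ.real {ω | ∑ i ∈ s, X i ω ∈ A} - Po(r).real A| ≤
      (r : ℝ)⁻¹ * ∑ i ∈ s, (∫ ω, (X i ω : ℝ) * (X i ω - 1) ∂μ +
        ∑ j ∈ N i, ∫ ω, (X i ω : ℝ) * X j ω ∂μ +
        (∫ ω, (X i ω : ℝ) ∂μ) * (∫ ω, (X i ω : ℝ) ∂μ + ∑ j ∈ N i, ∫ ω, (X j ω : ℝ) ∂μ)) := by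
  have hmeas {t : Finset ι} (ht : t ⊆ s) : Measurable fun ω => ∑ j ∈ t, X j ω :=
    Finset.measurable_fun_sum t fun j hj => hX j (ht hj)
  have hmemLp {t : Finset ι} (ht : t ⊆ s) : MemLp (fun ω => ((∑ j ∈ t, X j ω : ℕ) : ℝ)) 2 μ := by
    simpa only [Nat.cast_sum] using memLp_finsetSum t fun j hj => hX_memLp j (ht hj)
  have hprod {i j : ι} (hi : i ∈ s) (hj : j ∈ s) :
      Integrable (fun ω => (X i ω : ℝ) * X j ω) μ :=
    (hX_memLp i hi).integrable_mul (hX_memLp j hj)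
  set S : Ω → ℕ := fun ω => ∑ i ∈ s, X i ω
  set f := steinSolution r A
  have hS_meas : Measurable S := hmeas subset_rfl
  have hS : MemLp (fun ω => (S ω : ℝ)) 2 μ := hmemLp subset_rfl
  have hf : ∀ k, |f (k + 1) - f k| ≤ (r : ℝ)⁻¹ := abs_steinSolution_succ_sub_le hr A
  have hXf (i : ι) (hi : i ∈ s) : Integrable (fun ω => (X i ω : ℝ) * f (S ω)) μ :=
    (hX_memLp i hi).integrable_mul (memLp_comp_of_abs_succ_sub_le hf hS_meas hS)
  have hstein : μ.real (S ⁻¹' A) - Po(r).real A =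
      ∑ i ∈ s, ((∫ ω, (X i ω : ℝ) ∂μ) * ∫ ω, f (S ω + 1) ∂μ -
        ∫ ω, (X i ω : ℝ) * f (S ω) ∂μ) := by
    rw [← integral_steinSolution_equation hr hS_meas hS, Finset.sum_sub_distrib,
      ← Finset.sum_mul, ← hmean, ← integral_finsetSum s hXf]
    simp only [S, f, Nat.cast_sum, Finset.sum_mul]
  change |μ.real (S ⁻¹' A) - _| ≤ _
  rw [hstein, Finset.mul_sum]
  refine (Finset.abs_sum_le_sum_abs _ _).trans (Finset.sum_le_sum fun i hi => ?_)
  have hNs : N i ⊆ s := (hN i hi).trans (Finset.erase_subset i s)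
  have hWs : s.erase i \ N i ⊆ s := Finset.sdiff_subset.trans (Finset.erase_subset i s)
  have hsplit (ω : Ω) : S ω = ∑ j ∈ s.erase i \ N i, X j ω + X i ω + ∑ j ∈ N i, X j ω := by
    rw [add_right_comm, Finset.sum_sdiff (hN i hi), Finset.sum_erase_add s _ hi]
  have hlocal := abs_integral_mul_sub_mul_integral_le hf (hmeas hWs) (hX i hi) (hmeas hNs)
    (hmemLp hWs) (hX_memLp i hi) (hmemLp hNs) (hindep i hi)
  simp only [← hsplit, Nat.cast_sum, Finset.mul_sum] at hlocal
  rwa [integral_finsetSum _ fun j hj => hprod hi (hNs hj),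
    integral_finsetSum _ fun j hj => (hX_memLp j (hNs hj)).integrable one_le_two] at hlocal

end ChenStein

section MDependence

lemma measurable_iSup_comap {Ω ι β : Type*} [mβ : MeasurableSpace β] {X : ι → Ω → β} {I : Set ι}
    {i : ι} (hi : i ∈ I) : Measurable[⨆ i ∈ I, mβ.comap (X i)] (X i) :=
  Measurable.of_comap_le (le_iSup₂ (f := fun i (_ : i ∈ I) => mβ.comap (X i)) i hi)

lemma measurable_sum_iSup_comap {Ω ι β : Type*} [mβ : MeasurableSpace β] [AddCommMonoid β]
    [MeasurableAdd₂ β] {X : ι → Ω → β} {I : Set ι} {t : Finset ι} (ht : ∀ i ∈ t, i ∈ I) :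
    Measurable[⨆ i ∈ I, mβ.comap (X i)] fun ω => ∑ i ∈ t, X i ω :=
  Finset.measurable_fun_sum t fun i hi => measurable_iSup_comap (ht i hi)

variable {Ω : Type*} [MeasurableSpace Ω] {μ : Measure Ω}

lemma indepFun_prodMk_right [IsFiniteMeasure μ] {α β γ : Type*} [MeasurableSpace α]
    [MeasurableSpace β] [MeasurableSpace γ] {Y : Ω → α} {U : Ω → β} {V : Ω → γ}
    (hY : Measurable Y) (hU : Measurable U) (hV : Measurable V) (hYU : IndepFun Y U μ)
    (hYUV : IndepFun (fun ω => (Y ω, U ω)) V μ) :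
    IndepFun Y (fun ω => (U ω, V ω)) μ := by
  have hUV : IndepFun U V μ := hYUV.comp measurable_snd measurable_id
  rw [indepFun_iff_map_prod_eq_prod_map_map hY.aemeasurable (hU.prodMk hV).aemeasurable]
  refine Measure.ext_prod₃ fun {s t u} hs ht hu => ?_
  rw [Measure.prod_prod, Measure.map_apply (hY.prodMk (hU.prodMk hV)) (hs.prod (ht.prod hu)),
    Measure.map_apply hY hs, Measure.map_apply (hU.prodMk hV) (ht.prod hu)]
  calc μ ((fun ω => (Y ω, U ω, V ω)) ⁻¹' s ×ˢ t ×ˢ u)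
      = μ ((fun ω => (Y ω, U ω)) ⁻¹' (s ×ˢ t) ∩ V ⁻¹' u) := by
        congr 1
        ext ω
        simp [and_assoc]
    _ = μ (Y ⁻¹' s ∩ U ⁻¹' t) * μ (V ⁻¹' u) :=
        hYUV.measure_inter_preimage_eq_mul _ _ (hs.prod ht) hu
    _ = μ (Y ⁻¹' s) * μ (U ⁻¹' t ∩ V ⁻¹' u) := by
        rw [hYU.measure_inter_preimage_eq_mul _ _ hs ht,
          hUV.measure_inter_preimage_eq_mul _ _ ht hu, mul_assoc]

lemma indepFun_of_indep {β γ : Type*} [MeasurableSpace β] [MeasurableSpace γ]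
    {m₁ m₂ : MeasurableSpace Ω} (h : Indep m₁ m₂ μ) {g : Ω → β} {g' : Ω → γ}
    (hg : Measurable[m₁] g) (hg' : Measurable[m₂] g') : IndepFun g g' μ :=
  indep_of_indep_of_le_left (indep_of_indep_of_le_right h hg'.comap_le) hg.comap_le

variable {m n : ℕ} {X : ℕ → Ω → ℕ}

lemma MDependent.indep [IsZeroOrProbabilityMeasure μ] (h : MDependent m n μ X) {s t : ℕ}
    (hst : 0 < s → s + m < t) :
    Indep (⨆ i ∈ Icc 1 s, MeasurableSpace.comap (X i) ⊤)
      (⨆ i ∈ Icc t n, MeasurableSpace.comap (X i) ⊤) μ := by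
  rcases s.eq_zero_or_pos with rfl | hs
  · simpa using indep_bot_left _
  rcases le_or_gt t n with ht | ht
  · exact h s t hs (hst hs) ht
  · simpa [Icc_eq_empty_of_lt ht] using indep_bot_right _

lemma MDependent.indepFun_sum_far [IsProbabilityMeasure μ] (h : MDependent m n μ X)
    (hX : ∀ k, 1 ≤ k → k ≤ n → Measurable (X k)) {k : ℕ} (hk1 : 1 ≤ k) (hkn : k ≤ n) :
    IndepFun (X k) (fun ω => ∑ j ∈ Finset.Icc 1 n with j + m < k ∨ k + m < j, X j ω) μ := by
  set past : Finset ℕ := {j ∈ Finset.Icc 1 n | j + m < k}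
  set future : Finset ℕ := {j ∈ Finset.Icc 1 n | k + m < j}
  have hmeas (p : ℕ → Prop) [DecidablePred p] :
      Measurable fun ω => ∑ j ∈ Finset.Icc 1 n with p j, X j ω :=
    Finset.measurable_fun_sum _ fun j hj => by
      simp only [Finset.mem_filter, Finset.mem_Icc] at hj
      exact hX j hj.1.1 hj.1.2
  have hpast_mem {s : ℕ} (hs : k - (m + 1) ≤ s) : ∀ j ∈ past, j ∈ Icc 1 s := fun j hj => by
    simp only [past, Finset.mem_filter, Finset.mem_Icc, mem_Icc] at hj ⊢
    omega
  have hfuture_mem : ∀ j ∈ future, j ∈ Icc (k + m + 1) n := fun j hj => by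
    simp only [future, Finset.mem_filter, Finset.mem_Icc, mem_Icc] at hj ⊢
    omega
  have hpast : IndepFun (X k) (fun ω => ∑ j ∈ past, X j ω) μ :=
    (indepFun_of_indep (h.indep (s := k - (m + 1)) (t := k) (by omega))
      (measurable_sum_iSup_comap (hpast_mem le_rfl))
      (measurable_iSup_comap (mem_Icc.2 ⟨le_rfl, hkn⟩))).symm
  have hfuture :
      IndepFun (fun ω => (X k ω, ∑ j ∈ past, X j ω)) (fun ω => ∑ j ∈ future, X j ω) μ :=
    indepFun_of_indep (h.indep (s := k) (t := k + m + 1) (by omega))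
      ((measurable_iSup_comap (mem_Icc.2 ⟨hk1, le_rfl⟩)).prodMk
        (measurable_sum_iSup_comap (hpast_mem (k.sub_le _))))
      (measurable_sum_iSup_comap hfuture_mem)
  have hsum (ω : Ω) : ∑ j ∈ Finset.Icc 1 n with j + m < k ∨ k + m < j, X j ω =
      ∑ j ∈ past, X j ω + ∑ j ∈ future, X j ω := by
    rw [Finset.filter_or, Finset.sum_union (Finset.disjoint_filter.2 fun j _ => by omega)]
  simp only [hsum]
  exact (indepFun_prodMk_right (hX k hk1 hkn) (hmeas _) (hmeas _) hpast hfuture).comp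
    measurable_id (measurable_fst.add measurable_snd)

end MDependence

section Row

variable {Ω : Type*} [MeasurableSpace Ω] {P : Measure Ω} {n : ℕ} {X : ℕ → Ω → ℕ}

lemma nu1_nonneg (P : Measure Ω) (X : ℕ → Ω → ℕ) : 0 ≤ nu1 P X :=
  integral_nonneg fun ω => by positivity

lemma nu2_nonneg (P : Measure Ω) (X : ℕ → Ω → ℕ) : 0 ≤ nu2 P X := by
  refine integral_nonneg fun ω => ?_
  rcases (X 1 ω).eq_zero_or_pos with h | h
  · simp [h]
  · exact mul_nonneg (by positivity) (sub_nonneg.2 (Nat.one_le_cast.2 h))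

lemma mixedMoment_nonneg (P : Measure Ω) (X : ℕ → Ω → ℕ) (k : ℕ) : 0 ≤ mixedMoment P X k :=
  integral_nonneg fun ω => by positivity

/-- The part of `Setting` that the Chen–Stein bound for `partialSum n X` consumes: a row
`X 1, …, X n` of identically distributed `1`-dependent variables, square integrable instead of
bounded, whose mixed moments are controlled by the first one. -/
structure OneDependentRow (n : ℕ) (P : Measure Ω) (X : ℕ → Ω → ℕ) : Prop where
  measurable : ∀ k, 1 ≤ k → k ≤ n → Measurable (X k)
  identDistrib : ∀ k, 1 ≤ k → k ≤ n → IdentDistrib (X k) (X 1) P P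
  oneDependent : MDependent 1 n P X
  mixedMoment_le : ∀ k, 1 ≤ k → k + 1 ≤ n → mixedMoment P X k ≤ mixedMoment P X 1
  memLp : MemLp (fun ω => (X 1 ω : ℝ)) 2 P

lemma Setting.oneDependentRow [IsFiniteMeasure P] {C₀ : ℝ} {x : ℕ} (h : Setting C₀ n P X x)
    (hn : 1 ≤ n) : OneDependentRow n P X where
  measurable := h.measurable
  identDistrib := h.identDistrib
  oneDependent := h.oneDependent
  mixedMoment_le := h.mixedMoment_le
  memLp := MemLp.of_bound
    (Measurable.of_discrete.comp (h.measurable 1 le_rfl hn)).aestronglyMeasurable C₀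
    (by simpa using h.bounded)

namespace OneDependentRow

lemma integral_comp (h : OneDependentRow n P X) {k : ℕ} (hk : k ∈ Finset.Icc 1 n) (g : ℕ → ℝ) :
    ∫ ω, g (X k ω) ∂P = ∫ ω, g (X 1 ω) ∂P := by
  rw [Finset.mem_Icc] at hk
  exact ((h.identDistrib k hk.1 hk.2).comp (u := g) .of_discrete).integral_eq

lemma memLp_apply (h : OneDependentRow n P X) {k : ℕ} (hk : k ∈ Finset.Icc 1 n) :
    MemLp (fun ω => (X k ω : ℝ)) 2 P := by
  rw [Finset.mem_Icc] at hk
  exact ((h.identDistrib k hk.1 hk.2).symm.comp (u := fun k : ℕ => (k : ℝ))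
    .of_discrete).memLp_snd h.memLp

lemma integral_mul_le (h : OneDependentRow n P X) {j k : ℕ} (hj : j ∈ Finset.Icc 1 n)
    (hk : k ∈ Finset.Icc 1 n) (hjk : j ≠ k) (hj_le : j ≤ k + 1) (hk_le : k ≤ j + 1) :
    ∫ ω, (X k ω : ℝ) * X j ω ∂P ≤ mixedMoment P X 1 := by
  rw [Finset.mem_Icc] at hj hk
  obtain rfl | rfl : j = k + 1 ∨ k = j + 1 := by omega
  · exact h.mixedMoment_le k hk.1 hj.2
  · simp only [mul_comm (X (j + 1) _ : ℝ)]
    exact h.mixedMoment_le j hj.1 hk.2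

lemma integral_eq_nu1 (h : OneDependentRow n P X) {k : ℕ} (hk : k ∈ Finset.Icc 1 n) :
    ∫ ω, (X k ω : ℝ) ∂P = nu1 P X :=
  h.integral_comp hk fun k => (k : ℝ)

lemma sum_neighbours_le (h : OneDependentRow n P X) {k : ℕ} (hk : k ∈ Finset.Icc 1 n)
    {t : Finset ℕ} (ht : ∀ j ∈ t, j ∈ Finset.Icc 1 n ∧ j ≠ k ∧ j ≤ k + 1 ∧ k ≤ j + 1) :
    ∫ ω, (X k ω : ℝ) * (X k ω - 1) ∂P + ∑ j ∈ t, ∫ ω, (X k ω : ℝ) * X j ω ∂P +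
        (∫ ω, (X k ω : ℝ) ∂P) * (∫ ω, (X k ω : ℝ) ∂P + ∑ j ∈ t, ∫ ω, (X j ω : ℝ) ∂P) ≤
      nu2 P X + 2 * mixedMoment P X 1 + 3 * nu1 P X ^ 2 := by
  have hcard : (t.card : ℝ) ≤ 2 := by
    have hsub : t ⊆ {k - 1, k + 1} := fun j hj => by
      have := ht j hj
      simp only [Finset.mem_insert, Finset.mem_singleton]
      omega
    exact_mod_cast (Finset.card_le_card hsub).trans Finset.card_le_two
  have hmixed : ∑ j ∈ t, ∫ ω, (X k ω : ℝ) * X j ω ∂P ≤ 2 * mixedMoment P X 1 := by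
    refine (Finset.sum_le_card_nsmul t _ _ fun j hj => ?_).trans
      ((nsmul_eq_mul _ _).trans_le
        (mul_le_mul_of_nonneg_right hcard (mixedMoment_nonneg P X 1)))
    obtain ⟨hj_mem, hjk, hj_le, hk_le⟩ := ht j hj
    exact h.integral_mul_le hj_mem hk hjk hj_le hk_le
  have hfactorial : ∫ ω, (X k ω : ℝ) * (X k ω - 1) ∂P = nu2 P X :=
    h.integral_comp hk fun k => (k : ℝ) * (k - 1)
  rw [hfactorial, h.integral_eq_nu1 hk,
    Finset.sum_congr rfl fun j hj => h.integral_eq_nu1 (ht j hj).1, Finset.sum_const,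
    nsmul_eq_mul]
  nlinarith [mul_le_mul_of_nonneg_right hcard (sq_nonneg (nu1 P X))]

theorem abs_measureReal_partialSum_sub_le [IsProbabilityMeasure P] (h : OneDependentRow n P X)
    (hpos : 0 < n * nu1 P X) (A : Set ℕ) :
    |P.real {ω | partialSum n X ω ∈ A} - Po((n * nu1 P X).toNNReal).real A| ≤
      (nu2 P X + 2 * mixedMoment P X 1 + 3 * nu1 P X ^ 2) / nu1 P X := by
  set N : ℕ → Finset ℕ := fun k => {j ∈ (Finset.Icc 1 n).erase k | j ≤ k + 1 ∧ k ≤ j + 1}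
  have hnear (k j : ℕ) (hj : j ∈ N k) : j ∈ Finset.Icc 1 n ∧ j ≠ k ∧ j ≤ k + 1 ∧ k ≤ j + 1 := by
    simp only [N, Finset.mem_filter, Finset.mem_erase] at hj
    tauto
  have hfar (k : ℕ) : (Finset.Icc 1 n).erase k \ N k =
      {j ∈ Finset.Icc 1 n | j + 1 < k ∨ k + 1 < j} := by
    ext j
    simp only [N, Finset.mem_sdiff, Finset.mem_filter, Finset.mem_erase, Finset.mem_Icc]
    omega
  have hindep : ∀ k ∈ Finset.Icc 1 n,
      IndepFun (X k) (fun ω => ∑ j ∈ (Finset.Icc 1 n).erase k \ N k, X j ω) P := fun k hk => by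
    rw [hfar]
    exact h.oneDependent.indepFun_sum_far h.measurable (Finset.mem_Icc.1 hk).1
      (Finset.mem_Icc.1 hk).2
  have hmean : ((n * nu1 P X).toNNReal : ℝ) = ∑ k ∈ Finset.Icc 1 n, ∫ ω, (X k ω : ℝ) ∂P := by
    simp [Finset.sum_congr rfl fun _ hk => h.integral_eq_nu1 hk, hpos.le]
  have hstein := abs_measureReal_sum_sub_poissonMeasure_le (toNNReal_pos.2 hpos)
    (fun k hk => h.measurable k (Finset.mem_Icc.1 hk).1 (Finset.mem_Icc.1 hk).2)
    (fun k hk => h.memLp_apply hk) (fun k _ => Finset.filter_subset _ _) hindep hmean A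
  refine hstein.trans ?_
  have hn : (n : ℝ) ≠ 0 := (pos_of_mul_pos_left hpos (nu1_nonneg P X)).ne'
  rw [coe_toNNReal _ hpos.le]
  calc (n * nu1 P X)⁻¹ * _
      ≤ (n * nu1 P X)⁻¹ * (n * (nu2 P X + 2 * mixedMoment P X 1 + 3 * nu1 P X ^ 2)) := by
        gcongr
        simpa only [nsmul_eq_mul, Nat.card_Icc, Nat.add_sub_cancel] using
          Finset.sum_le_card_nsmul (Finset.Icc 1 n) _ _ fun _ hk =>
            h.sum_neighbours_le hk (hnear _)
    _ = (nu2 P X + 2 * mixedMoment P X 1 + 3 * nu1 P X ^ 2) / nu1 P X := by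
        field_simp

end OneDependentRow

end Row

section Asymptotics

lemma tendsto_div_nhds_one_of_tendsto_sub {α : Type*} {F : Filter α} {a b p : α → ℝ} {c : ℝ}
    (hc : 0 < c) (hp : ∀ᶠ i in F, c ≤ p i) (ha : Tendsto (fun i => a i - p i) F (𝓝 0))
    (hb : Tendsto (fun i => b i - p i) F (𝓝 0)) : Tendsto (fun i => a i / b i) F (𝓝 1) := by
  have hone : (fun _ => (1 : ℝ)) =O[F] p := by
    refine IsBigO.of_bound c⁻¹ (hp.mono fun i hi => ?_)
    rw [norm_one, Real.norm_of_nonneg (hc.le.trans hi), inv_mul_eq_div, one_le_div hc]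
    exact hi
  have hap : IsEquivalent F a p := ((isLittleO_one_iff ℝ).2 ha).trans_isBigO hone
  have hbp : IsEquivalent F b p := ((isLittleO_one_iff ℝ).2 hb).trans_isBigO hone
  have hb_ne : ∀ᶠ i in F, b i ≠ 0 := by
    filter_upwards [hp, hb.eventually (lt_mem_nhds (neg_lt_zero.2 hc))] with i hpi hbi
    linarith
  exact (isEquivalent_iff_tendsto_one hb_ne).1 (hap.trans hbp.symm)

variable {α : Type*} {F : Filter α} {x : α → ℕ} {l ν : α → ℝ}

lemma exists_eventually_le_add_mul_sqrt (hxO : (fun i => x i - l i) =O[F] fun i => √(l i)) :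
    ∃ B, 0 ≤ B ∧ ∀ᶠ i in F, (x i : ℝ) ≤ l i + B * √(l i) := by
  obtain ⟨B, hB, hbound⟩ := hxO.exists_nonneg
  refine ⟨B, hB, hbound.bound.mono fun i hi => ?_⟩
  rw [Real.norm_of_nonneg (sqrt_nonneg _)] at hi
  linarith [le_abs_self ((x i : ℝ) - l i), Real.norm_eq_abs ((x i : ℝ) - l i)]

lemma isBigO_one_sqrt (hx : ∀ᶠ i in F, 0 < x i) (hl : ∀ i, 0 ≤ l i)
    (hxO : (fun i => x i - l i) =O[F] fun i => √(l i)) :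
    (fun _ => (1 : ℝ)) =O[F] fun i => √(l i) := by
  obtain ⟨B, hB, hbound⟩ := exists_eventually_le_add_mul_sqrt hxO
  refine IsBigO.of_bound (B + 1) ?_
  filter_upwards [hx, hbound] with i hxi hi
  rw [norm_one, Real.norm_of_nonneg (sqrt_nonneg _)]
  exact one_le_mul_sqrt_of_le_add_mul_sqrt hxi (hl i) hB hi

lemma eventually_ne_zero_of_isBigO_one_sqrt (hroot : (fun _ => (1 : ℝ)) =O[F] fun i => √(l i)) :
    ∀ᶠ i in F, l i ≠ 0 :=
  hroot.eq_zero_imp.mono fun i hi hl => one_ne_zero (hi (by rw [hl, sqrt_zero]))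

lemma tendsto_zero_of_isBigO_one_sqrt (hroot : (fun _ => (1 : ℝ)) =O[F] fun i => √(l i))
    (hνl : Tendsto (fun i => ν i * √(l i)) F (𝓝 0)) : Tendsto ν F (𝓝 0) :=
  (by simpa using (isBigO_refl ν F).mul hroot : ν =O[F] fun i => ν i * √(l i)).trans_tendsto hνl

lemma tendsto_mul_sqrt_natCast_mul {ν : ℕ → ℝ} (hν_nonneg : ∀ n, 0 ≤ ν n)
    (hν : (fun n : ℕ => n * ν n ^ 3) =o[atTop] fun _ => (1 : ℝ)) :
    Tendsto (fun n : ℕ => ν n * √(n * ν n)) atTop (𝓝 0) := by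
  have hsqrt := ((isLittleO_one_iff ℝ).1 hν).sqrt
  rw [sqrt_zero] at hsqrt
  refine hsqrt.congr fun n => ?_
  rw [show n * ν n ^ 3 = ν n ^ 2 * (n * ν n) by ring, sqrt_mul (sq_nonneg _),
    sqrt_sq (hν_nonneg n)]

lemma tendsto_div_one_sub_mul (hν : Tendsto ν F (𝓝 0))
    (hνl : Tendsto (fun i => ν i * √(l i)) F (𝓝 0))
    (hxO : (fun i => x i - l i) =O[F] fun i => √(l i)) :
    Tendsto (fun i => ν i / (1 - ν i) * (x i - l i)) F (𝓝 0) := by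
  have hnum : Tendsto (fun i => ν i * (x i - l i)) F (𝓝 0) :=
    ((isBigO_refl ν F).mul hxO).trans_tendsto hνl
  have hquot := hnum.div (hν.const_sub 1) (by norm_num)
  rw [zero_div] at hquot
  exact hquot.congr fun i => mul_div_right_comm _ _ _

lemma tendsto_div_of_isBigO_sq {a : α → ℝ} (hν : Tendsto ν F (𝓝 0))
    (ha : a =O[F] fun i => ν i ^ 2) : Tendsto (fun i => a i / ν i) F (𝓝 0) := by
  have hquot := ha.mul (isBigO_refl (fun i => (ν i)⁻¹) F)
  simp only [sq, mul_self_mul_inv, ← div_eq_mul_inv (a _)] at hquot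
  exact hquot.trans_tendsto hν

lemma tendsto_poissonMeasure_real_sub {d : α → ℝ}
    (hd : Tendsto (fun i => l i - d i) F (𝓝 0)) (A : α → Set ℕ) :
    Tendsto (fun i => Po((l i).toNNReal).real (A i) - Po((d i).toNNReal).real (A i)) F (𝓝 0) := by
  refine squeeze_zero_norm (fun i => ?_) ((tendsto_zero_iff_abs_tendsto_zero _).1 hd)
  refine (abs_poissonMeasure_real_sub_le _ _ _).trans ?_
  simpa only [coe_toNNReal', Function.comp_apply] using abs_max_sub_max_le_abs (l i) (d i) 0

end Asymptotics

section Moments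

variable {Ω : Type*} [MeasurableSpace Ω]

lemma max_le_gam {C₀ : ℝ} (hC₀ : 0 ≤ C₀) (P : Measure Ω) (X : ℕ → Ω → ℕ) :
    max (nu2 P X) (mixedMoment P X 1) ≤ gam C₀ P X :=
  (le_max_right (nu1 P X ^ 2) _).trans <| le_mul_of_one_le_left
    (le_max_of_le_left (sq_nonneg _)) (one_le_exp (by positivity))

lemma natCast_mul_lamStar {P : Measure Ω} {X : ℕ → Ω → ℕ} {n : ℕ} (x : ℕ)
    (h : n * nu1 P X ≠ 0) :
    n * lamStar n P X x = n * nu1 P X - nu1 P X / (1 - nu1 P X) * (x - n * nu1 P X) := by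
  rw [lamStar, yParam]
  linear_combination -(nu1 P X / (1 - nu1 P X)) * mul_div_cancel₀ (x - n * nu1 P X) h

end Moments

section Array

variable {Ω : ℕ → Type*} [∀ n, MeasurableSpace (Ω n)] {P : ∀ n, Measure (Ω n)}
  {X : ∀ n, ℕ → Ω n → ℕ} {x : ℕ → ℕ}

lemma nu2_isBigO_gam {C₀ : ℝ} (hC₀ : 0 ≤ C₀) (F : Filter ℕ) :
    (fun n => nu2 (P n) (X n)) =O[F] fun n => gam C₀ (P n) (X n) :=
  isBigO_of_le F fun _ => abs_le_abs_of_nonneg (nu2_nonneg _ _) <|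
    (le_max_left _ _).trans (max_le_gam hC₀ _ _)

lemma mixedMoment_isBigO_gam {C₀ : ℝ} (hC₀ : 0 ≤ C₀) (F : Filter ℕ) :
    (fun n => mixedMoment (P n) (X n) 1) =O[F] fun n => gam C₀ (P n) (X n) :=
  isBigO_of_le F fun _ => abs_le_abs_of_nonneg (mixedMoment_nonneg _ _ _) <|
    (le_max_right _ _).trans (max_le_gam hC₀ _ _)

lemma tendsto_natCast_mul_lamStar_sub
    (hl_ne : ∀ᶠ n : ℕ in atTop, n * nu1 (P n) (X n) ≠ 0)
    (hν : Tendsto (fun n => nu1 (P n) (X n)) atTop (𝓝 0))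
    (hνl : Tendsto (fun n : ℕ => nu1 (P n) (X n) * √(n * nu1 (P n) (X n))) atTop (𝓝 0))
    (hxO : (fun n : ℕ => (x n : ℝ) - n * nu1 (P n) (X n))
      =O[atTop] fun n : ℕ => √(n * nu1 (P n) (X n))) :
    Tendsto (fun n : ℕ => n * lamStar n (P n) (X n) (x n) - n * nu1 (P n) (X n)) atTop (𝓝 0) := by
  have hshift := (tendsto_div_one_sub_mul hν hνl hxO).neg
  rw [neg_zero] at hshift
  refine hshift.congr' (hl_ne.mono fun n hn => ?_)
  dsimp only
  rw [natCast_mul_lamStar (x n) hn, sub_sub_cancel_left]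

lemma tendsto_measureReal_partialSum_sub [∀ n, IsProbabilityMeasure (P n)]
    (hrow : ∀ᶠ n in atTop, OneDependentRow n (P n) (X n))
    (hpos : ∀ᶠ n : ℕ in atTop, 0 < n * nu1 (P n) (X n))
    (hν : Tendsto (fun n => nu1 (P n) (X n)) atTop (𝓝 0))
    (hν₂ : (fun n => nu2 (P n) (X n)) =O[atTop] fun n => nu1 (P n) (X n) ^ 2)
    (hmix : (fun n => mixedMoment (P n) (X n) 1) =O[atTop] fun n => nu1 (P n) (X n) ^ 2)
    (A : ℕ → Set ℕ) :
    Tendsto (fun n : ℕ => (P n).real {ω | partialSum n (X n) ω ∈ A n} -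
      Po((n * nu1 (P n) (X n)).toNNReal).real (A n)) atTop (𝓝 0) := by
  have hnum := (hν₂.add (hmix.const_mul_left 2)).add
    ((isBigO_refl (fun n => nu1 (P n) (X n) ^ 2) atTop).const_mul_left 3)
  refine squeeze_zero_norm' ?_ (tendsto_div_of_isBigO_sq hν hnum)
  filter_upwards [hrow, hpos] with n hn hn_pos
  exact hn.abs_measureReal_partialSum_sub_le hn_pos (A n)

end Array

end PoissonLD

theorem corollary2_general
    {Ω : ℕ → Type*} [∀ n, MeasurableSpace (Ω n)]
    {P : ∀ n, Measure (Ω n)} [∀ n, IsProbabilityMeasure (P n)]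
    {X : ∀ n, ℕ → Ω n → ℕ} {x : ℕ → ℕ}
    (hrow : ∀ᶠ n in atTop, PoissonLD.OneDependentRow n (P n) (X n))
    (hx : ∀ᶠ n in atTop, 0 < x n)
    (hxO : (fun n : ℕ => (x n : ℝ) - n * PoissonLD.nu1 (P n) (X n))
      =O[atTop] fun n : ℕ => √(n * PoissonLD.nu1 (P n) (X n)))
    (hν₂ : (fun n => PoissonLD.nu2 (P n) (X n))
      =O[atTop] fun n => PoissonLD.nu1 (P n) (X n) ^ 2)
    (hmix : (fun n => PoissonLD.mixedMoment (P n) (X n) 1)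
      =O[atTop] fun n => PoissonLD.nu1 (P n) (X n) ^ 2)
    (hν : (fun n : ℕ => (n : ℝ) * PoissonLD.nu1 (P n) (X n) ^ 3)
      =o[atTop] fun _ => (1 : ℝ)) :
    Tendsto (fun n : ℕ =>
      (P n).real {ω | x n ≤ PoissonLD.partialSum n (X n) ω} /
        (poissonMeasure
          (Real.toNNReal (n * PoissonLD.lamStar n (P n) (X n) (x n)))).real (Set.Ici (x n)))
      atTop (𝓝 1) := by
  have hν_nonneg (n : ℕ) := PoissonLD.nu1_nonneg (P n) (X n)
  have hl_nonneg (n : ℕ) := mul_nonneg n.cast_nonneg (hν_nonneg n)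
  have hroot := PoissonLD.isBigO_one_sqrt hx hl_nonneg hxO
  have hl_ne := PoissonLD.eventually_ne_zero_of_isBigO_one_sqrt hroot
  have hνl := PoissonLD.tendsto_mul_sqrt_natCast_mul hν_nonneg hν
  have hν_zero := PoissonLD.tendsto_zero_of_isBigO_one_sqrt hroot hνl
  have hrate := PoissonLD.tendsto_natCast_mul_lamStar_sub hl_ne hν_zero hνl hxO
  obtain ⟨B, hB, hxB⟩ := PoissonLD.exists_eventually_le_add_mul_sqrt hxO
  obtain ⟨c, hc, hlower⟩ := PoissonLD.exists_pos_le_poissonMeasure_real_Ici hB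
  refine PoissonLD.tendsto_div_nhds_one_of_tendsto_sub hc (hxB.mono fun n hn => hlower _ _ ?_)
    (PoissonLD.tendsto_measureReal_partialSum_sub hrow
      (hl_ne.mono fun n hn => (hl_nonneg n).lt_of_ne' hn) hν_zero hν₂ hmix fun n => Set.Ici (x n))
    (PoissonLD.tendsto_poissonMeasure_real_sub hrate fun n => Set.Ici (x n))
  rwa [Real.coe_toNNReal _ (hl_nonneg n)]

theorem corollary2
    (C₀ : ℝ) (hC₀ : 1 ≤ C₀)
    (Ω : ℕ → Type*) [∀ n, MeasurableSpace (Ω n)]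
    (P : ∀ n, Measure (Ω n)) [∀ n, IsProbabilityMeasure (P n)]
    (X : ∀ n, ℕ → Ω n → ℕ) (x : ℕ → ℕ)
    (hset : ∀ᶠ n in atTop, PoissonLD.Setting C₀ n (P n) (X n) (x n))
    (hx : ∀ᶠ n : ℕ in atTop, (n : ℝ) * PoissonLD.nu1 (P n) (X n) < (x n : ℝ))
    (hxO : (fun n : ℕ => (x n : ℝ) - n * PoissonLD.nu1 (P n) (X n))
      =O[atTop] (fun n : ℕ => Real.sqrt (n * PoissonLD.nu1 (P n) (X n))))
    (hγ : (fun n : ℕ => PoissonLD.gam C₀ (P n) (X n))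
      =O[atTop] (fun n : ℕ => PoissonLD.nu1 (P n) (X n) ^ 2))
    (hν : (fun n : ℕ => (n : ℝ) * PoissonLD.nu1 (P n) (X n) ^ 3)
      =o[atTop] (fun _ => (1 : ℝ))) :
    Tendsto (fun n : ℕ =>
      (P n).real {ω | x n ≤ PoissonLD.partialSum n (X n) ω} /
        (poissonMeasure
          (Real.toNNReal (n * PoissonLD.lamStar n (P n) (X n) (x n)))).real (Set.Ici (x n)))
      atTop (𝓝 1) := by
  have hC₀_nonneg : 0 ≤ C₀ := zero_le_one.trans hC₀
  exact corollary2_general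
    ((hset.and (eventually_ge_atTop 1)).mono fun n hn => hn.1.oneDependentRow hn.2)
    (hset.mono fun n hn => hn.x_pos) hxO
    ((PoissonLD.nu2_isBigO_gam hC₀_nonneg atTop).trans hγ)
    ((PoissonLD.mixedMoment_isBigO_gam hC₀_nonneg atTop).trans hγ) hν
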